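/- Let $W\ge 0$ be an integer and let $\lambda>0$, $T>0$, $\sigma>0$ and $0\le r<1$ be real numbers. A \emph{fair-load station} is described by the discrete-time Markov chain $(K,N)$, where $N\in\{0,1,2,\dots\}$ is the number of packets in its infinite buffer and $K\in\{0,\dots,W\}$ is its back-off counter, with $K=0$ whenever $N=0$. The chain is observed at the ends of successive slots. Independently of everything else, each slot is a full slot (duration $T$) with probability $r$ or a mini-slot (duration $\sigma$) with probability $1-r$. During a slot of duration $\Delta$, a Poisson number $j$ of packets with mean $\lambda\Delta$ arrives. A back-off value $U$ is drawn, when needed, uniformly on $\{0,\dots,W\}$. The transitions are as follows. \begin{itemize} \item From $(0,0)$ (idle): to $(0,0)$ if $j=0$, and to $(U,j)$ if $j\ge1$. \item From $(0,n)$, $n\ge1$: in a full slot one packet is transmitted and the chain moves to $(U,n-1+j)$ if $n-1+j\ge1$, and to $(0,0)$ if $n-1+j=0$; in a mini-slot nothing is transmitted and the chain moves to $(U,n+j)$. \item From $(k,n)$, $k\ge1$, $n\ge1$: to $(k,n+j)$ in a full slot, and to $(k-1,n+j)$ in a mini-slot. \end{itemize} Let \[ u(x)=\frac{1-re^{-\lambda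 T(1-x)}}{(1-r)e^{-\lambda\sigma(1-x)}},\qquad \overline R(x)=\frac{re^{-\lambda T(1-x)}}{x}+(1-r)e^{-\lambda\sigma(1-x)}-\frac{(W+1)\,u^W(x)\,(1-u(x))}{1-u^{W+1}(x)}, \] where the last fraction is extended continuously to $x=1$, that is, read as $(W+1)u^W(x)\big/\sum_{i=0}^W u^i(x)$. Then $\overline R$ is differentiable at $1$, and the chain is ergodic (irreducible, aperiodic and positive recurrent) if and only if $\overline R'(1)<0$, which is equivalent to \[ \lambda<\frac{r(1-r)}{\left[1-r+\frac W2\right]\left[rT+(1-r)\sigma\right]}. \] In this case the chain has exactly one stationary distribution $q$, its $n$-step transition probabilities from every state converge to $q$ as $n\to\infty$, and the idle probability is \[ q(0,0)=1-\frac{\lambda\,[rT+(1-r)\sigma]\left[1+\frac{W}{2(1-r)}\right]}{r}. \] -/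

import Mathlib

open ProbabilityTheory Filter Topology
open scoped NNReal ENNReal

/-! ### Discrete-time Markov chains on a countable state space

A chain is given by its transition probabilities `P : S → PMF S`; `P x y` is the probability
of a transition from `x` to `y`. -/

namespace CountableChain

noncomputable section

/-- Law of the chain after `n` steps, started from a given state. -/
def nStep {S : Type*} (P : S → PMF S) : ℕ → S → PMF S
  | 0, x => PMF.pure x
  | n + 1, x => (P x).bind (nStep P n)

/-- Every state can be reached from every state. -/
def IsIrreducible {S : Type*} (P : S → PMF S) : Prop :=
  ∀ x y : S, ∃ n : ℕ, 0 < nStep P n x y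

/-- Every state has period one: the only common divisor of the possible return times is `1`. -/
def IsAperiodic {S : Type*} (P : S → PMF S) : Prop :=
  ∀ x : S, ∀ d : ℕ, (∀ n : ℕ, 0 < nStep P n x x → d ∣ n) → d = 1

open Classical in
/-- Probability that the chain started from `x` visits `a`, at a time at least `1`,
for the first time at time `n`. -/
def firstPassage {S : Type*} (P : S → PMF S) (a : S) : ℕ → S → ℝ≥0∞
  | 0, _ => 0
  | 1, x => P x a
  | n + 2, x => ∑' y : S, if y = a then 0 else P x y * firstPassage P a (n + 1) y

/-- Every state is revisited with probability one, and its mean return time is finite. -/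
def IsPositiveRecurrent {S : Type*} (P : S → PMF S) : Prop :=
  ∀ a : S, ∑' n : ℕ, firstPassage P a n a = 1 ∧
    ∑' n : ℕ, (n : ℝ≥0∞) * firstPassage P a n a < ∞

/-- An ergodic chain: irreducible, aperiodic and positive recurrent. -/
def IsErgodic {S : Type*} (P : S → PMF S) : Prop :=
  IsIrreducible P ∧ IsAperiodic P ∧ IsPositiveRecurrent P

/-- A stationary distribution: a probability distribution preserved by one transition. -/
def IsStationary {S : Type*} (P : S → PMF S) (q : PMF S) : Prop :=
  q.bind P = q

end

end CountableChain

/-! ### The fair-load station -/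

namespace FairLoad

/-- States of the station: pairs `(k, n)` of a back-off counter `k ∈ {0, …, W}` and a number `n`
of packets in the (infinite) buffer; the counter of an empty station is `0`. -/
def State (W : ℕ) : Type :=
  {s : Fin (W + 1) × ℕ // s.2 = 0 → s.1 = 0}

namespace State

/-- The state `(k, n)` if `n ≥ 1`, and the idle state `(0, 0)` if `n = 0`. -/
def mk' {W : ℕ} (k : Fin (W + 1)) (n : ℕ) : State W :=
  ⟨(if n = 0 then 0 else k, n), fun h => if_pos h⟩

/-- The idle state `(0, 0)`. -/
def idle (W : ℕ) : State W :=
  ⟨(0, 0), fun _ => rfl⟩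

/-- The back-off counter. -/
def counter {W : ℕ} (s : State W) : Fin (W + 1) := s.1.1

/-- The number of packets. -/
def packets {W : ℕ} (s : State W) : ℕ := s.1.2

end State

/-- The state after one slot, given the type of the slot (`full = true` for a full slot, `false`
for a mini-slot), the number `j` of packets that arrive during it, and the draw `u` of a new
back-off value (used only if one is needed).
* An empty station stays idle if nothing arrives, and otherwise draws a back-off value.
* A station with packets and counter `0` transmits one packet in a full slot and transmits none in
  a mini-slot; in both cases it draws a new back-off value if it has packets left.
* A station with counter `k ≥ 1` keeps its counter in a full slot, decrements it in a mini-slot. -/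
def next {W : ℕ} (s : State W) (full : Bool) (j : ℕ) (u : Fin (W + 1)) : State W :=
  if s.packets = 0 then State.mk' u j
  else if s.counter = 0 then
    State.mk' u (if full then s.packets - 1 + j else s.packets + j)
  else
    State.mk'
      (if full then s.counter else ⟨s.counter.val - 1, by have := s.counter.isLt; omega⟩)
      (s.packets + j)

noncomputable section

/-- The slot type: full with probability `r`, a mini-slot with probability `1 - r`. -/
def slotType (r : ℝ≥0) (hr : r ≤ 1) : PMF Bool :=
  PMF.ofFintype (fun b => if b then (r : ℝ≥0∞) else ((1 - r : ℝ≥0) : ℝ≥0∞)) (by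
    simp only [Fintype.sum_bool, if_true, Bool.false_eq_true, if_false]
    rw [← ENNReal.coe_add, add_tsub_cancel_of_le hr, ENNReal.coe_one])

/-- The number of packets that arrive during a time `t`: Poisson with mean `lam * t`. -/
def arrivals (lam t : ℝ≥0) : PMF ℕ :=
  (poissonMeasure (lam * t)).toPMF

/-- Transition probabilities of the chain `(K, N)` observed at the successive slot boundaries:
the slot is full (duration `T`) with probability `r`, and a mini-slot (duration `σ`) with
probability `1 - r`, independently of everything else; arrivals are Poisson with rate `lam`;
new back-off values are uniform on `{0, …, W}`. -/
def step (W : ℕ) (lam T σ r : ℝ≥0) (hr : r ≤ 1) (s : State W) : PMF (State W) :=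
  (slotType r hr).bind fun full =>
    (arrivals lam (if full then T else σ)).bind fun j =>
      (PMF.uniformOfFintype (Fin (W + 1))).map fun u => next s full j u

/-! ### The function `Rbar` -/

/-- `a(x) = (1 - r) e^{-λσ(1-x)}`. -/
def a (lam σ r x : ℝ) : ℝ := (1 - r) * Real.exp (-lam * σ * (1 - x))

/-- `b(x) = 1 - r e^{-λT(1-x)}`. -/
def b (lam T r x : ℝ) : ℝ := 1 - r * Real.exp (-lam * T * (1 - x))

/-- `u(x) = b(x) / a(x)`. -/
def u (lam T σ r x : ℝ) : ℝ := b lam T r x / a lam σ r x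

/-- `R̄(x) = r e^{-λT(1-x)} / x + (1 - r) e^{-λσ(1-x)} - (W+1) u(x)^W / (1 + u(x) + ⋯ + u(x)^W)`.
Where `u(x) ≠ 1`, the last term is `(W+1) u(x)^W (1 - u(x)) / (1 - u(x)^(W+1))`; the sum in the
denominator extends that expression continuously to `x = 1`, where `u(1) = 1`. -/
def Rbar (W : ℕ) (lam T σ r x : ℝ) : ℝ :=
  r * Real.exp (-lam * T * (1 - x)) / x + (1 - r) * Real.exp (-lam * σ * (1 - x))
    - (W + 1) * u lam T σ r x ^ W / ∑ i ∈ Finset.range (W + 1), u lam T σ r x ^ i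

theorem Rbar_eq (W : ℕ) (lam T σ r x : ℝ) (hx : u lam T σ r x ≠ 1) :
    Rbar W lam T σ r x =
      r * Real.exp (-lam * T * (1 - x)) / x + (1 - r) * Real.exp (-lam * σ * (1 - x))
        - (W + 1) * u lam T σ r x ^ W * (1 - u lam T σ r x)
          / (1 - u lam T σ r x ^ (W + 1)) := by
  have h1 : 1 - u lam T σ r x ≠ 0 := sub_ne_zero.mpr (Ne.symm hx)
  rw [Rbar, ← geom_sum_mul_neg, mul_div_mul_right _ _ h1]

end

end FairLoad

/-! The criterion comes from one linear test function. A decrement of the counter takes `g =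
1/(1-r)` slots on average, and `C = (1 + gW/2)/r` makes serving one packet worth `C` slots. Give the
state `(k, n)` with `n ≥ 1` the workload `Cn + gk`, and the idle state the workload `gW/2`, the mean
weight of a fresh draw. With `β = Cλ(rT + (1-r)σ)`, the mean work arriving per slot, the drift is
exactly `β - 1` off the idle state and `β` at it (`expect_workload_add_one`).

If `β < 1`, Foster's criterion gives a finite mean return time to the idle state
(`tsum_survive_lt_top_of_drift`), and the normalized occupation measure of an excursion is
stationary (`exists_isStationary`). Conversely, under any stationary `q` the mean drift vanishes, so
`β + q(0,0) = 1` (`idle_add_load_eq_one`). Irreducibility makes `q(0,0)` positive, which forces `β <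
1`; the same identity is the idle formula. Integrability of the workload under `q` is not known
beforehand; bounded downward jumps replace it (`IsStationary.expect_drift_eq`).

A stationary distribution of an irreducible chain makes every state positive recurrent by Kac's
formula. The idle state has a self-loop, so the chain is aperiodic and two independent copies form
an irreducible chain; coupling them gives convergence and uniqueness. Finally the derivative of
`Rbar` at `1` is `r(β - 1)`. For `r = 0` the chain is not irreducible and this derivative is
nonnegative. -/

namespace CountableChain

noncomputable section

/-! ### Expectations of nonnegative functions -/

/-- Expectation of a nonnegative function under a discrete distribution. -/
def expect {S : Type*} (p : PMF S) (f : S → ℝ≥0∞) : ℝ≥0∞ := ∑' x, p x * f x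

section Expect

variable {S S' : Type*}

lemma expect_add (p : PMF S) (f g : S → ℝ≥0∞) :
    expect p (fun x => f x + g x) = expect p f + expect p g := by
  simp only [expect, mul_add, ENNReal.tsum_add]

lemma expect_const_mul (p : PMF S) (c : ℝ≥0∞) (f : S → ℝ≥0∞) :
    expect p (fun x => c * f x) = c * expect p f := by
  simp only [expect, ← ENNReal.tsum_mul_left, mul_left_comm]

lemma expect_const (p : PMF S) (c : ℝ≥0∞) : expect p (fun _ => c) = c := by
  simp only [expect, ENNReal.tsum_mul_right, p.tsum_coe, one_mul]

lemma expect_mono (p : PMF S) {f g : S → ℝ≥0∞} (h : ∀ x, p x ≠ 0 → f x ≤ g x) :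
    expect p f ≤ expect p g := by
  refine ENNReal.tsum_le_tsum fun x => ?_
  by_cases hx : p x = 0
  · simp [hx]
  · gcongr
    exact h x hx

lemma expect_pure (x : S) (f : S → ℝ≥0∞) : expect (PMF.pure x) f = f x := by
  rw [expect, tsum_eq_single x]
  · simp
  · intro y hy
    simp [PMF.pure_apply, hy]

lemma expect_bind (p : PMF S) (k : S → PMF S') (f : S' → ℝ≥0∞) :
    expect (p.bind k) f = expect p fun x => expect (k x) f := by
  simp only [expect, PMF.bind_apply, ← ENNReal.tsum_mul_right, ← ENNReal.tsum_mul_left]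
  rw [ENNReal.tsum_comm]
  simp only [mul_assoc]

lemma expect_map (p : PMF S) (k : S → S') (f : S' → ℝ≥0∞) :
    expect (p.map k) f = expect p fun x => f (k x) := by
  rw [← PMF.bind_pure_comp, expect_bind]
  simp only [Function.comp, expect_pure]

lemma bind_apply_eq_expect (p : PMF S) (k : S → PMF S') (y : S') :
    p.bind k y = expect p fun x => k x y := rfl

lemma mul_le_expect (p : PMF S) (f : S → ℝ≥0∞) (x : S) : p x * f x ≤ expect p f :=
  ENNReal.le_tsum x

open Classical in
lemma expect_indicator (p : PMF S) (a : S) :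
    expect p (fun x => if x = a then 1 else 0) = p a := by
  simp [expect]

lemma tendsto_tsum_of_monotone {f : ℕ → S → ℝ≥0∞} {g : S → ℝ≥0∞}
    (hf : ∀ x, Monotone fun n => f n x) (h : ∀ x, Tendsto (fun n => f n x) atTop (𝓝 (g x))) :
    Tendsto (fun n => ∑' x, f n x) atTop (𝓝 (∑' x, g x)) := by
  let _ : MeasurableSpace S := ⊤
  simp only [← MeasureTheory.lintegral_count]
  exact MeasureTheory.lintegral_tendsto_of_tendsto_of_monotone
    (fun n => measurable_from_top.aemeasurable) (.of_forall hf) (.of_forall h)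

lemma tendsto_expect_of_monotone (p : PMF S) {f : ℕ → S → ℝ≥0∞} {g : S → ℝ≥0∞}
    (hf : ∀ x, Monotone fun n => f n x) (h : ∀ x, Tendsto (fun n => f n x) atTop (𝓝 (g x))) :
    Tendsto (fun n => expect p (f n)) atTop (𝓝 (expect p g)) :=
  tendsto_tsum_of_monotone (fun x _ _ hmn => mul_le_mul_right (hf x hmn) _)
    fun x => ENNReal.Tendsto.const_mul (h x) (.inr (p.apply_ne_top x))

lemma tendsto_expect_of_bounded (p : PMF S) {f : ℕ → S → ℝ≥0∞} {g : S → ℝ≥0∞}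
    (hf : ∀ n x, f n x ≤ 1) (h : ∀ x, Tendsto (fun n => f n x) atTop (𝓝 (g x))) :
    Tendsto (fun n => expect p (f n)) atTop (𝓝 (expect p g)) := by
  let _ : MeasurableSpace S := ⊤
  simp only [expect, ← MeasureTheory.lintegral_count]
  refine MeasureTheory.tendsto_lintegral_of_dominated_convergence (fun x => p x)
    (fun n => measurable_from_top) (fun n => .of_forall fun x => ?_) ?_ (.of_forall fun x => ?_)
  · simpa using mul_le_mul_right (hf n x) (p x)
  · rw [MeasureTheory.lintegral_count]
    exact p.tsum_coe_ne_top
  · exact ENNReal.Tendsto.const_mul (h x) (.inr (p.apply_ne_top x))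

end Expect

/-! ### Iterates of the transition probabilities -/

section General

variable {S : Type*} {P : S → PMF S}

lemma nStep_succ_apply (n : ℕ) (x y : S) :
    nStep P (n + 1) x y = expect (P x) fun z => nStep P n z y := rfl

lemma nStep_add (m n : ℕ) (x : S) : nStep P (m + n) x = (nStep P m x).bind (nStep P n) := by
  induction m generalizing x with
  | zero => simp [nStep]
  | succ m ih =>
    rw [Nat.succ_add]
    simp only [nStep, PMF.bind_bind]
    exact congrArg (P x).bind (funext ih)

lemma nStep_one (x : S) : nStep P 1 x = P x := by
  change (P x).bind PMF.pure = P x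
  exact PMF.bind_pure _

lemma nStep_add_pos {m n : ℕ} {x y z : S} (h : 0 < nStep P m x y) (h' : 0 < nStep P n y z) :
    0 < nStep P (m + n) x z := by
  rw [nStep_add, bind_apply_eq_expect]
  exact (ENNReal.mul_pos h.ne' h'.ne').trans_le (mul_le_expect _ _ y)

lemma IsStationary.expect_eq {q : PMF S} (hq : IsStationary P q) (f : S → ℝ≥0∞) :
    expect q (fun x => expect (P x) f) = expect q f := by
  rw [← expect_bind, hq]

lemma IsStationary.bind_nStep {q : PMF S} (hq : IsStationary P q) (n : ℕ) :
    q.bind (nStep P n) = q := by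
  induction n with
  | zero => exact PMF.bind_pure q
  | succ n ih =>
    change q.bind (fun x => (P x).bind (nStep P n)) = q
    rw [← PMF.bind_bind, show q.bind P = q from hq, ih]

lemma IsStationary.pos {q : PMF S} (hq : IsStationary P q) (hP : IsIrreducible P) (a : S) :
    0 < q a := by
  obtain ⟨x, hx⟩ := q.support_nonempty
  obtain ⟨n, hn⟩ := hP x a
  rw [← hq.bind_nStep n, bind_apply_eq_expect]
  exact (ENNReal.mul_pos hx hn.ne').trans_le (mul_le_expect _ _ x)

/-! ### Survival probabilities and Kac's formula -/

open Classical in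
/-- Probability that the chain started from `x` does not visit `a` at the times `1, …, n`. -/
def survive (P : S → PMF S) (a : S) : ℕ → S → ℝ≥0∞
  | 0, _ => 1
  | n + 1, x => expect (P x) fun y => if y = a then 0 else survive P a n y

lemma survive_le_one (a : S) (n : ℕ) (x : S) : survive P a n x ≤ 1 := by
  induction n generalizing x with
  | zero => exact le_rfl
  | succ n ih =>
    refine (expect_mono (P x) (g := fun _ => 1) fun y _ => ?_).trans_eq (expect_const _ _)
    split_ifs
    · exact zero_le_one
    · exact ih y

lemma survive_succ_le (a : S) (n : ℕ) (x : S) : survive P a (n + 1) x ≤ survive P a n x := by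
  induction n generalizing x with
  | zero => exact survive_le_one a 1 x
  | succ n ih =>
    refine expect_mono (P x) fun y _ => ?_
    split_ifs
    · exact le_rfl
    · exact ih y

lemma survive_antitone (a x : S) : Antitone fun n => survive P a n x :=
  antitone_nat_of_succ_le fun n => survive_succ_le a n x

lemma firstPassage_add_survive (a : S) (n : ℕ) (x : S) :
    firstPassage P a (n + 1) x + survive P a (n + 1) x = survive P a n x := by
  classical
  induction n generalizing x with
  | zero =>
    have h1 : expect (P x) (fun y => (if y = a then 1 else 0) + if y = a then 0 else 1) = 1 := by
      refine Eq.trans (congrArg (expect (P x)) (funext fun y => ?_)) (expect_const (P x) 1)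
      split_ifs <;> simp
    rw [expect_add, expect_indicator] at h1
    exact h1
  | succ n ih =>
    have h1 : firstPassage P a (n + 2) x
        = expect (P x) fun y => if y = a then 0 else firstPassage P a (n + 1) y := by
      simp only [firstPassage, expect, mul_ite, mul_zero]
    rw [h1]
    change _ + expect (P x) _ = expect (P x) _
    rw [← expect_add]
    congr 1
    funext y
    split_ifs
    · simp
    · exact ih y

lemma sum_firstPassage_add_survive (a : S) (n : ℕ) (x : S) :
    ∑ k ∈ Finset.range n, firstPassage P a (k + 1) x + survive P a n x = 1 := by
  induction n with
  | zero => simp [survive]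
  | succ n ih => rw [Finset.sum_range_succ, add_assoc, firstPassage_add_survive, ih]

/-- Decomposition by the last visit to `a` among the times `1, …, n`: under `q` it occurs `k` steps
before the end with probability `q a * survive P a k a`, and the second term is the event of no
visit. Letting `n` grow bounds the mean return time by `1 / q a`. -/
lemma IsStationary.kac {q : PMF S} (hq : IsStationary P q) (a : S) (n : ℕ) :
    q a * ∑ k ∈ Finset.range n, survive P a k a + expect q (survive P a n) = 1 := by
  classical
  induction n with
  | zero => simp [survive, expect_const]
  | succ n ih =>
    have h1 : q a * survive P a n a + expect q (survive P a (n + 1))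
        = expect q (survive P a n) := by
      have h2 : expect q (survive P a (n + 1))
          = expect q fun y => if y = a then 0 else survive P a n y := hq.expect_eq _
      have h3 : q a * survive P a n a
          = expect q fun y => if y = a then survive P a n y else 0 := by
        simp [expect]
      rw [h2, h3, ← expect_add]
      congr 1
      funext y
      split_ifs <;> simp
    rw [Finset.sum_range_succ, mul_add, add_assoc, h1, ih]

lemma IsStationary.tsum_survive_lt_top {q : PMF S} (hq : IsStationary P q) {a : S} (ha : 0 < q a) :
    ∑' n, survive P a n a < ∞ := by
  have h : q a * ∑' n, survive P a n a ≤ 1 := by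
    rw [← ENNReal.tsum_mul_left]
    refine ENNReal.tsum_le_of_sum_range_le fun n => ?_
    rw [← Finset.mul_sum]
    exact le_self_add.trans_eq (hq.kac a n)
  by_contra htop
  rw [not_lt, top_le_iff] at htop
  rw [htop, ENNReal.mul_top ha.ne'] at h
  exact absurd h (by simp)

lemma tsum_firstPassage_eq_one {a x : S} (h : Tendsto (fun n => survive P a n x) atTop (𝓝 0)) :
    ∑' n, firstPassage P a n x = 1 := by
  have h1 : Tendsto (fun n => ∑ k ∈ Finset.range n, firstPassage P a (k + 1) x
      + survive P a n x) atTop (𝓝 (∑' n, firstPassage P a (n + 1) x + 0)) :=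
    (ENNReal.tendsto_nat_tsum _).add h
  simp only [sum_firstPassage_add_survive, add_zero] at h1
  rw [tsum_eq_zero_add' ENNReal.summable, ← tendsto_nhds_unique h1 tendsto_const_nhds]
  simp [firstPassage]

lemma survive_eq_tsum {a x : S} (h : Tendsto (fun n => survive P a n x) atTop (𝓝 0)) (n : ℕ) :
    survive P a n x = ∑' k, firstPassage P a (n + k + 1) x := by
  have h1 : ∀ m, ∑ k ∈ Finset.range m, firstPassage P a (n + k + 1) x + survive P a (n + m) x
      = survive P a n x := by
    intro m
    induction m with
    | zero => simp
    | succ m ih =>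
      rw [Finset.sum_range_succ, add_assoc, ← add_assoc n m 1, firstPassage_add_survive, ih]
  have h2 := (ENNReal.tendsto_nat_tsum fun k => firstPassage P a (n + k + 1) x).add
    (h.comp (tendsto_add_atTop_nat n))
  simp only [Function.comp, add_comm _ n, h1, add_zero] at h2
  exact tendsto_nhds_unique tendsto_const_nhds h2

/-- The term `f m` is counted once for each `n < m`. Applied to first-passage probabilities, this is
the formula for the mean return time as a sum of tails. -/
lemma tsum_tsum_add_eq (f : ℕ → ℝ≥0∞) :
    ∑' n : ℕ, ∑' k : ℕ, f (n + k + 1) = ∑' n : ℕ, (n : ℝ≥0∞) * f n := by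
  have h1 : ∀ n : ℕ, ∑' k : ℕ, f (n + k + 1) = ∑' m : ℕ, if n < m then f m else 0 := by
    intro n
    rw [← Summable.sum_add_tsum_nat_add' (f := fun m : ℕ => if n < m then f m else 0)
      (k := n + 1) ENNReal.summable, Finset.sum_eq_zero, zero_add]
    · refine tsum_congr fun k => ?_
      rw [if_pos (by omega)]
      congr 1
      omega
    · intro i hi
      rw [if_neg (by simp at hi; omega)]
  simp only [h1]
  rw [ENNReal.tsum_comm]
  refine tsum_congr fun m => ?_
  rw [tsum_eq_sum (s := Finset.range m)]
  · rw [Finset.sum_congr rfl (g := fun _ => f m)]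
    · simp
    · intro i hi
      rw [if_pos (Finset.mem_range.1 hi)]
  · intro i hi
    rw [if_neg (by simpa using hi)]

lemma tendsto_survive_of_tsum_lt_top {a x : S} (h : ∑' n, survive P a n x < ∞) :
    Tendsto (fun n => survive P a n x) atTop (𝓝 0) :=
  ENNReal.tendsto_atTop_zero_of_tsum_ne_top h.ne

lemma IsStationary.isPositiveRecurrent {q : PMF S} (hq : IsStationary P q)
    (hP : IsIrreducible P) : IsPositiveRecurrent P := by
  intro a
  have h := hq.tsum_survive_lt_top (hq.pos hP a)
  have h0 := tendsto_survive_of_tsum_lt_top h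
  refine ⟨tsum_firstPassage_eq_one h0, ?_⟩
  rwa [← tsum_tsum_add_eq fun n => firstPassage P a n a, ← tsum_congr (survive_eq_tsum h0)]

lemma IsPositiveRecurrent.tsum_survive_lt_top (h : IsPositiveRecurrent P) (a : S) :
    ∑' n, survive P a n a < ∞ := by
  obtain ⟨h1, h2⟩ := h a
  have h0 : Tendsto (fun n => survive P a n a) atTop (𝓝 0) := by
    have h3 : ∀ n, survive P a n a = 1 - ∑ k ∈ Finset.range n, firstPassage P a (k + 1) a := by
      intro n
      have h4 := sum_firstPassage_add_survive (P := P) a n a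
      refine ENNReal.eq_sub_of_add_eq (fun htop => ?_) ?_
      · rw [htop, top_add] at h4
        exact absurd h4 (by simp)
      · rwa [add_comm]
    rw [tsum_eq_zero_add' ENNReal.summable] at h1
    have h5 := (ENNReal.Tendsto.sub (tendsto_const_nhds (x := (1 : ℝ≥0∞)))
      (ENNReal.tendsto_nat_tsum fun k => firstPassage P a (k + 1) a) (.inl ENNReal.one_ne_top))
    simp only [firstPassage, zero_add] at h1
    rw [h1, tsub_self] at h5
    exact h5.congr fun n => (h3 n).symm
  rw [tsum_congr (survive_eq_tsum h0), tsum_tsum_add_eq fun n => firstPassage P a n a]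
  exact h2

/-! ### The occupation measure of an excursion -/

open Classical in
/-- Probability that the chain started from `a` is at `y` at time `n` and has not visited `a` at the
times `1, …, n`. -/
def taboo (P : S → PMF S) (a : S) : ℕ → S → ℝ≥0∞
  | 0, y => if y = a then 1 else 0
  | n + 1, y => if y = a then 0 else ∑' x, taboo P a n x * P x y

/-- One step of the chain killed on returning to `a`; the second summand restores the killed mass.
-/
lemma tsum_taboo_mul (a : S) (n : ℕ) (f : S → ℝ≥0∞) :
    ∑' y, taboo P a (n + 1) y * f y + (∑' x, taboo P a n x * P x a) * f a
      = ∑' x, taboo P a n x * expect (P x) f := by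
  classical
  have h1 : ∑' x, taboo P a n x * expect (P x) f
      = ∑' y, (∑' x, taboo P a n x * P x y) * f y := by
    simp only [expect, ← ENNReal.tsum_mul_left, ← ENNReal.tsum_mul_right]
    rw [ENNReal.tsum_comm]
    simp only [mul_assoc]
  have h2 : (∑' x, taboo P a n x * P x a) * f a
      = ∑' y, if y = a then (∑' x, taboo P a n x * P x y) * f y else 0 := by
    simp
  rw [h1, h2, ← ENNReal.tsum_add]
  refine tsum_congr fun y => ?_
  simp only [taboo]
  split_ifs <;> simp

lemma tsum_taboo_mul_survive (a : S) (m n : ℕ) :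
    ∑' x, taboo P a m x * survive P a n x = survive P a (m + n) a := by
  classical
  induction m generalizing n with
  | zero => simp [taboo]
  | succ m ih =>
    rw [add_right_comm, add_assoc, ← ih (n + 1)]
    change _ = ∑' x, taboo P a m x * expect (P x) _
    rw [← tsum_taboo_mul]
    simp only [if_true, mul_zero, add_zero]
    refine tsum_congr fun y => ?_
    simp only [taboo]
    split_ifs <;> simp

lemma tsum_taboo (a : S) (n : ℕ) : ∑' x, taboo P a n x = survive P a n a := by
  simpa [survive] using tsum_taboo_mul_survive (P := P) a n 0

/-- The occupation measure of an excursion from `a` has the mean return time as its mass. A further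
step only shifts the time index, and the mass lost at time `0` is recovered because the return to
`a` is certain. -/
lemma exists_isStationary {a : S} (h : ∑' n, survive P a n a < ∞) :
    ∃ q : PMF S, IsStationary P q := by
  classical
  set ν : S → ℝ≥0∞ := fun y => ∑' n, taboo P a n y with hν
  have hmass : ∑' y, ν y = ∑' n, survive P a n a := by
    rw [hν, ENNReal.tsum_comm]
    exact tsum_congr (tsum_taboo a)
  have hswap : ∀ y, ∑' x, ν x * P x y = ∑' n, ∑' x, taboo P a n x * P x y := by
    intro y
    simp only [hν, ← ENNReal.tsum_mul_right]
    exact ENNReal.tsum_comm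
  have hret : ∀ n, ∑' x, taboo P a n x * P x a = firstPassage P a (n + 1) a := by
    intro n
    have h1 := tsum_taboo_mul (P := P) a n (fun _ => 1)
    have h2 := firstPassage_add_survive (P := P) a n a
    simp only [mul_one, expect_const, tsum_taboo] at h1
    rw [add_comm] at h1
    exact (ENNReal.add_left_inj
      ((survive_le_one a (n + 1) a).trans_lt ENNReal.one_lt_top).ne).1 (h1.trans h2.symm)
  have hinv : ∀ y, ∑' x, ν x * P x y = ν y := by
    intro y
    rw [hswap]
    by_cases hy : y = a
    · subst hy
      have h1 := tsum_firstPassage_eq_one (tendsto_survive_of_tsum_lt_top h)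
      rw [tsum_eq_zero_add' ENNReal.summable] at h1
      simp only [firstPassage, zero_add] at h1
      simp only [hret, h1, hν]
      rw [tsum_eq_zero_add' ENNReal.summable]
      simp [taboo]
    · simp only [hν]
      rw [tsum_eq_zero_add' (f := fun n => taboo P a n y) ENNReal.summable]
      simp [taboo, hy]
  have h0 : ∑' y, ν y ≠ 0 := by
    rw [hmass]
    intro h0
    have := ENNReal.tsum_eq_zero.1 h0 0
    simp [survive] at this
  have htop : ∑' y, ν y ≠ ∞ := by
    rw [hmass]
    exact h.ne
  refine ⟨PMF.normalize ν h0 htop, PMF.ext fun y => ?_⟩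
  simp only [PMF.bind_apply, PMF.normalize_apply, mul_right_comm]
  rw [ENNReal.tsum_mul_right, hinv]

/-- Foster's criterion. -/
lemma tsum_survive_lt_top_of_drift {a : S} {g : S → ℝ≥0∞} {ε : ℝ≥0∞} (hε : ε ≠ 0)
    (hdrift : ∀ x, x ≠ a → expect (P x) g + ε ≤ g x) (ha : expect (P a) g ≠ ∞) :
    ∑' n, survive P a n a < ∞ := by
  classical
  -- The telescoping starts at time `1`, since the drift bound is not assumed at `a`; from then on
  -- the taboo law gives `a` no mass.
  have hstep : ∀ n, ∑' y, taboo P a (n + 2) y * g y + ε * survive P a (n + 1) a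
      ≤ ∑' y, taboo P a (n + 1) y * g y := by
    intro n
    rw [← tsum_taboo, ← ENNReal.tsum_mul_left]
    refine (add_le_add_left (le_self_add.trans_eq (tsum_taboo_mul a (n + 1) g)) _).trans ?_
    rw [← ENNReal.tsum_add]
    refine ENNReal.tsum_le_tsum fun x => ?_
    by_cases hx : x = a
    · simp [taboo, hx]
    · rw [mul_comm ε, ← mul_add]
      gcongr
      exact hdrift x hx
  have hsum : ∀ n, ∑' y, taboo P a (n + 1) y * g y
      + ε * ∑ k ∈ Finset.range n, survive P a (k + 1) a ≤ ∑' y, taboo P a 1 y * g y := by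
    intro n
    induction n with
    | zero => simp
    | succ n ih =>
      rw [Finset.sum_range_succ, mul_add, add_comm (ε * _), ← add_assoc]
      exact (add_le_add_left (hstep n) _).trans ih
  have hfin : ∑' y, taboo P a 1 y * g y ≤ expect (P a) g := by
    refine (le_self_add.trans_eq (tsum_taboo_mul a 0 g)).trans_eq ?_
    simp [taboo]
  have hle : ε * ∑' n, survive P a (n + 1) a ≤ expect (P a) g := by
    rw [← ENNReal.tsum_mul_left]
    refine ENNReal.tsum_le_of_sum_range_le fun n => ?_
    rw [← Finset.mul_sum]
    exact (le_add_self.trans (hsum n)).trans hfin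
  rw [tsum_eq_zero_add' ENNReal.summable]
  refine ENNReal.add_lt_top.2 ⟨(survive_le_one a 0 a).trans_lt ENNReal.one_lt_top, ?_⟩
  by_contra htop
  rw [not_lt, top_le_iff] at htop
  rw [htop, ENNReal.mul_top hε, top_le_iff] at hle
  exact ha hle

/-! ### Convergence to the stationary distribution -/

/-- The limit `h` is the probability of never visiting `a`. It vanishes at `a` by Kac's formula and
is therefore harmonic everywhere, so it vanishes at every state reachable from `a`. -/
lemma IsStationary.tendsto_survive {q : PMF S} (hq : IsStationary P q) (hP : IsIrreducible P)
    (a x : S) : Tendsto (fun n => survive P a n x) atTop (𝓝 0) := by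
  classical
  set h : S → ℝ≥0∞ := fun x => ⨅ n, survive P a n x with hdef
  have hlim : ∀ x, Tendsto (fun n => survive P a n x) atTop (𝓝 (h x)) :=
    fun x => tendsto_atTop_iInf (survive_antitone a x)
  have ha : h a = 0 := tendsto_nhds_unique (hlim a)
    (tendsto_survive_of_tsum_lt_top (hq.tsum_survive_lt_top (hq.pos hP a)))
  have hharm : ∀ x, expect (P x) h = h x := by
    intro x
    refine tendsto_nhds_unique ?_ ((tendsto_add_atTop_iff_nat 1).2 (hlim x))
    refine tendsto_expect_of_bounded (P x) (fun n y => ?_) fun y => ?_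
    · split_ifs
      · exact zero_le_one
      · exact survive_le_one a n y
    · by_cases hy : y = a
      · simp [hy, ha]
      · simpa [hy] using hlim y
  have hn : ∀ n x, expect (nStep P n x) h = h x := by
    intro n
    induction n with
    | zero => intro x; exact expect_pure x h
    | succ n ih =>
      intro x
      simp only [nStep, expect_bind, ih, hharm]
  obtain ⟨n, hpos⟩ := hP a x
  have h1 := (mul_le_expect (nStep P n a) h x).trans_eq (hn n a)
  rw [ha, nonpos_iff_eq_zero, mul_eq_zero] at h1
  rw [← h1.resolve_left hpos.ne']
  exact hlim x

/-- The product of two distributions. -/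
def prodLaw {S' : Type*} (p : PMF S) (p' : PMF S') : PMF (S × S') :=
  p.bind fun x => p'.map fun y => (x, y)

lemma expect_prodLaw {S' : Type*} (p : PMF S) (p' : PMF S') (f : S × S' → ℝ≥0∞) :
    expect (prodLaw p p') f = expect p fun x => expect p' fun y => f (x, y) := by
  simp only [prodLaw, expect_bind, expect_map]

lemma prodLaw_apply {S' : Type*} (p : PMF S) (p' : PMF S') (x : S) (y : S') :
    prodLaw p p' (x, y) = p x * p' y := by
  classical
  rw [← expect_indicator, expect_prodLaw]
  simp only [Prod.mk.injEq]
  have h1 : ∀ x', (expect p' fun y' => if x' = x ∧ y' = y then 1 else 0)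
      = p' y * if x' = x then 1 else 0 := by
    intro x'
    by_cases hx : x' = x
    · simp [hx, expect_indicator]
    · simp [hx, expect_const]
  simp only [h1, expect_const_mul, expect_indicator]
  exact mul_comm _ _

/-- Two independent copies of a chain. -/
def pairChain (P : S → PMF S) (s : S × S) : PMF (S × S) := prodLaw (P s.1) (P s.2)

lemma pmf_ext_expect {p p' : PMF S} (h : ∀ f, expect p f = expect p' f) : p = p' := by
  classical
  refine PMF.ext fun x => ?_
  rw [← expect_indicator p x, h, expect_indicator]

lemma expect_comm {S' : Type*} (p : PMF S) (p' : PMF S') (f : S → S' → ℝ≥0∞) :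
    expect p (fun x => expect p' fun y => f x y) = expect p' fun y => expect p fun x => f x y := by
  simp only [expect, ← ENNReal.tsum_mul_left]
  rw [ENNReal.tsum_comm]
  simp only [mul_left_comm]

lemma nStep_pairChain (n : ℕ) (x y : S) :
    nStep (pairChain P) n (x, y) = prodLaw (nStep P n x) (nStep P n y) := by
  refine pmf_ext_expect fun f => ?_
  induction n generalizing x y with
  | zero => simp [nStep, expect_prodLaw, expect_pure]
  | succ n ih =>
    rw [expect_prodLaw]
    simp only [nStep, expect_bind, pairChain, expect_prodLaw, ih]
    congr 1
    funext x'
    rw [expect_comm]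

lemma IsStationary.pairChain {q : PMF S} (hq : IsStationary P q) :
    IsStationary (pairChain P) (prodLaw q q) := by
  refine pmf_ext_expect fun f => ?_
  simp only [CountableChain.pairChain, expect_bind, expect_prodLaw]
  have h1 : ∀ x, (expect q fun y => expect (P x) fun x' => expect (P y) fun y' => f (x', y'))
      = expect (P x) fun x' => expect q fun y' => f (x', y') := by
    intro x
    rw [expect_comm]
    congr 1
    funext x'
    exact hq.expect_eq _
  simp only [h1]
  exact hq.expect_eq _

/-- A path through `a` can be lengthened at will by repeating the loop there. This lets two
independent copies arrive at their targets simultaneously. -/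
lemma exists_forall_ge_nStep_pos (hP : IsIrreducible P) {a : S} (ha : 0 < P a a) (x y : S) :
    ∃ N, ∀ n ≥ N, 0 < nStep P n x y := by
  have hloop : ∀ n, 0 < nStep P n a a := by
    intro n
    induction n with
    | zero => simp [nStep]
    | succ n ih => exact nStep_add_pos ih (by rwa [nStep_one])
  obtain ⟨m, hm⟩ := hP x a
  obtain ⟨k, hk⟩ := hP a y
  refine ⟨m + k, fun n hn => ?_⟩
  obtain ⟨d, rfl⟩ := Nat.exists_eq_add_of_le hn
  rw [add_right_comm]
  exact nStep_add_pos (nStep_add_pos hm (hloop d)) hk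

lemma isAperiodic_of_pos (hP : IsIrreducible P) {a : S} (ha : 0 < P a a) : IsAperiodic P := by
  intro x d hd
  obtain ⟨N, hN⟩ := exists_forall_ge_nStep_pos hP ha x x
  have h1 := hd N (hN N le_rfl)
  have h2 := hd (N + 1) (hN _ (by omega))
  exact Nat.dvd_one.1 ((Nat.dvd_add_right h1).1 h2)

lemma isIrreducible_pairChain (hP : IsIrreducible P) {a : S} (ha : 0 < P a a) :
    IsIrreducible (pairChain P) := by
  rintro ⟨x, y⟩ ⟨x', y'⟩
  obtain ⟨N, hN⟩ := exists_forall_ge_nStep_pos hP ha x x'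
  obtain ⟨M, hM⟩ := exists_forall_ge_nStep_pos hP ha y y'
  refine ⟨N + M, ?_⟩
  rw [nStep_pairChain, prodLaw_apply]
  exact ENNReal.mul_pos (hN _ (by omega)).ne' (hM _ (by omega)).ne'

/-- The coupling inequality. -/
lemma nStep_le_add_survive (a z : S) (n : ℕ) (x y : S) :
    nStep P n x z ≤ nStep P n y z + survive (pairChain P) (a, a) n (x, y) := by
  classical
  induction n generalizing x y with
  | zero => exact (PMF.coe_le_one _ _).trans le_add_self
  | succ n ih =>
    have h1 : nStep P (n + 1) x z = expect (pairChain P (x, y)) fun s => nStep P n s.1 z := by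
      simp only [pairChain, expect_prodLaw, expect_const]
      rfl
    have h2 : nStep P (n + 1) y z = expect (pairChain P (x, y)) fun s => nStep P n s.2 z := by
      simp only [pairChain, expect_prodLaw]
      rw [expect_const]
      rfl
    rw [h1, h2]
    change _ ≤ _ + expect (pairChain P (x, y)) _
    rw [← expect_add]
    refine expect_mono _ fun s _ => ?_
    -- Once both copies are at `a`, their remaining laws agree, so the copies need not be glued
    -- together.
    split_ifs with hs
    · simp [hs]
    · exact ih s.1 s.2

lemma IsStationary.tendsto_nStep {q : PMF S} (hq : IsStationary P q) (hP : IsIrreducible P)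
    {a : S} (ha : 0 < P a a) (x z : S) :
    Tendsto (fun n => nStep P n x z) atTop (𝓝 (q z)) := by
  have hsurv := hq.pairChain.tendsto_survive (isIrreducible_pairChain hP ha) (a, a)
  have hx : Tendsto
      (fun n => expect q fun y => survive (CountableChain.pairChain P) (a, a) n (x, y)) atTop (𝓝 0) := by
    have h1 := tendsto_expect_of_bounded q
      (fun n y => survive_le_one (P := CountableChain.pairChain P) (a, a) n (x, y))
      (fun y => hsurv (x, y))
    rwa [expect_const] at h1
  have hx' : Tendsto
      (fun n => expect q fun y => survive (CountableChain.pairChain P) (a, a) n (y, x)) atTop (𝓝 0) := by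
    have h1 := tendsto_expect_of_bounded q
      (fun n y => survive_le_one (P := CountableChain.pairChain P) (a, a) n (y, x))
      (fun y => hsurv (y, x))
    rwa [expect_const] at h1
  have hqn : ∀ n, (expect q fun y => nStep P n y z) = q z := fun n => by
    rw [← bind_apply_eq_expect, hq.bind_nStep]
  -- The second copy starts from `q` and so keeps the law `q`; exchanging the two copies gives the
  -- lower bound.
  have hle : ∀ n, nStep P n x z
      ≤ q z + expect q fun y => survive (CountableChain.pairChain P) (a, a) n (x, y) := by
    intro n
    rw [← hqn n, ← expect_add, ← expect_const q (nStep P n x z)]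
    exact expect_mono _ fun y _ => nStep_le_add_survive a z n x y
  have hge : ∀ n, q z - (expect q fun y => survive (CountableChain.pairChain P) (a, a) n (y, x))
      ≤ nStep P n x z := by
    intro n
    rw [tsub_le_iff_right, ← hqn n, ← expect_const q (nStep P n x z), ← expect_add]
    exact expect_mono _ fun y _ => nStep_le_add_survive a z n y x
  refine tendsto_of_tendsto_of_tendsto_of_le_of_le ?_ ?_ hge hle
  · simpa using ENNReal.Tendsto.sub (tendsto_const_nhds (x := q z)) hx' (.inl (q.apply_ne_top z))
  · simpa using (tendsto_const_nhds (x := q z)).add hx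

lemma IsStationary.unique {q q' : PMF S} (hq : IsStationary P q) (hP : IsIrreducible P)
    {a : S} (ha : 0 < P a a) (hq' : IsStationary P q') : q' = q := by
  refine PMF.ext fun z => ?_
  have h1 := tendsto_expect_of_bounded q' (fun n x => (nStep P n x).coe_le_one z)
    (fun x => hq.tendsto_nStep hP ha x z)
  rw [expect_const] at h1
  simp only [← bind_apply_eq_expect, hq'.bind_nStep] at h1
  exact tendsto_nhds_unique tendsto_const_nhds h1

/-! ### The balance equation of a function with bounded downward jumps -/

/-- Monotonicity in the truncation level allows monotone convergence without integrability of the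
function being truncated. -/
lemma monotone_min_sub_min (x y : ℝ≥0∞) :
    Monotone fun M : ℕ => min y (M : ℝ≥0∞) - min x (M : ℝ≥0∞) := by
  intro M N hMN
  have hMN' : (M : ℝ≥0∞) ≤ N := by exact_mod_cast hMN
  dsimp only
  rcases le_total x M with hx | hx
  · rw [min_eq_left hx, min_eq_left (hx.trans hMN')]
    exact tsub_le_tsub_right (min_le_min_left _ hMN') _
  · rw [min_eq_right hx, tsub_eq_zero_of_le (min_le_right _ _)]
    exact zero_le

lemma tendsto_min_sub_min {x y : ℝ≥0∞} (hx : x ≠ ∞) (hy : y ≠ ∞) :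
    Tendsto (fun M : ℕ => min y (M : ℝ≥0∞) - min x (M : ℝ≥0∞)) atTop (𝓝 (y - x)) := by
  refine tendsto_const_nhds.congr' ?_
  obtain ⟨m, hm⟩ := ENNReal.exists_nat_gt (max_lt hx.lt_top hy.lt_top).ne
  filter_upwards [eventually_ge_atTop m] with M hM
  have hM' : max x y ≤ (M : ℝ≥0∞) := hm.le.trans (by exact_mod_cast hM)
  rw [min_eq_left ((le_max_right _ _).trans hM'), min_eq_left ((le_max_left _ _).trans hM')]

lemma add_expect_tsub (p : PMF S) (f : S → ℝ≥0∞) (c : ℝ≥0∞) :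
    (c + expect p fun y => f y - c) = expect p f + expect p fun y => c - f y := by
  calc (c + expect p fun y => f y - c)
      = expect p (fun _ => c) + expect p fun y => f y - c := by rw [expect_const]
    _ = _ := by
      rw [← expect_add, ← expect_add]
      refine congrArg (expect p) (funext fun y => ?_)
      rw [add_tsub_eq_max, add_tsub_eq_max, max_comm]

/-- Under a stationary distribution the upward and the downward jumps of a function have equal
expectations, even when the function is not integrable. -/
lemma IsStationary.expect_jumps_eq {q : PMF S} (hq : IsStationary P q) {f : S → ℝ≥0∞}
    (hf : ∀ x, f x ≠ ∞) :
    (expect q fun x => expect (P x) fun y => f y - f x)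
      = expect q fun x => expect (P x) fun y => f x - f y := by
  -- The truncated function is bounded, so its finite mean can be cancelled.
  have hM : ∀ M : ℕ, (expect q fun x => expect (P x) fun y => min (f y) M - min (f x) M)
      = expect q fun x => expect (P x) fun y => min (f x) M - min (f y) M := by
    intro M
    have h1 : (expect q fun x => min (f x) M)
        + (expect q fun x => expect (P x) fun y => min (f y) M - min (f x) M)
        = (expect q fun x => min (f x) M)
        + expect q fun x => expect (P x) fun y => min (f x) M - min (f y) M := by
      conv_rhs => rw [← hq.expect_eq]
      rw [← expect_add, ← expect_add]
      exact congrArg (expect q) (funext fun x => add_expect_tsub _ _ _)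
    refine (ENNReal.add_right_inj ?_).1 h1
    refine (lt_of_le_of_lt ((expect_mono q fun x _ => min_le_right _ _).trans_eq
      (expect_const q M)) (ENNReal.natCast_lt_top M)).ne
  have hlim : ∀ F G : S → S → ℝ≥0∞, (∀ x y, F x y ≠ ∞) → (∀ x y, G x y ≠ ∞) →
      Tendsto (fun M : ℕ => expect q fun x => expect (P x) fun y => min (F x y) M - min (G x y) M)
        atTop (𝓝 (expect q fun x => expect (P x) fun y => F x y - G x y)) := by
    intro F G hF hG
    refine tendsto_expect_of_monotone q (fun x M N hMN => ?_) fun x => ?_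
    · exact expect_mono _ fun y _ => monotone_min_sub_min _ _ hMN
    · exact tendsto_expect_of_monotone _ (fun y => monotone_min_sub_min _ _)
        fun y => tendsto_min_sub_min (hG x y) (hF x y)
  have h1 := hlim (fun _ y => f y) (fun x _ => f x) (fun _ y => hf y) (fun x _ => hf x)
  have h2 := hlim (fun x _ => f x) (fun _ y => f y) (fun x _ => hf x) (fun _ y => hf y)
  simp only [hM] at h1
  exact tendsto_nhds_unique h1 h2

/-- The jumps down have expectation at most `K`, hence so do the jumps up, and this common finite
value cancels. The drift is split between `A` and `B` to avoid truncated subtraction. -/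
lemma IsStationary.expect_drift_eq {q : PMF S} (hq : IsStationary P q) {f A B : S → ℝ≥0∞}
    {K : ℝ≥0∞} (hK : K ≠ ∞) (hf : ∀ x, f x ≠ ∞) (hdown : ∀ x y, P x y ≠ 0 → f x ≤ f y + K)
    (hdrift : ∀ x, expect (P x) f + A x = f x + B x) :
    expect q A = expect q B := by
  have hfin : (expect q fun x => expect (P x) fun y => f x - f y) ≠ ∞ := by
    refine ne_top_of_le_ne_top hK ?_
    refine (expect_mono q (g := fun _ => K) fun x _ => ?_).trans_eq (expect_const q K)
    refine (expect_mono (P x) (g := fun _ => K) fun y hy => ?_).trans_eq (expect_const _ K)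
    rw [tsub_le_iff_left]
    exact hdown x y hy
  have hx : ∀ x, (expect (P x) fun y => f y - f x) + A x
      = (expect (P x) fun y => f x - f y) + B x := by
    intro x
    have h1 : f x + (expect (P x) fun y => f y - f x)
        = expect (P x) f + expect (P x) fun y => f x - f y := add_expect_tsub _ _ _
    refine (ENNReal.add_right_inj (hf x)).1 ?_
    calc f x + ((expect (P x) fun y => f y - f x) + A x)
        = expect (P x) f + A x + expect (P x) fun y => f x - f y := by
          rw [← add_assoc, h1]; ring
      _ = _ := by rw [hdrift]; ring
  have h2 : (expect q fun x => expect (P x) fun y => f y - f x) + expect q A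
      = (expect q fun x => expect (P x) fun y => f x - f y) + expect q B := by
    rw [← expect_add, ← expect_add]
    simp only [hx]
  rw [hq.expect_jumps_eq hf] at h2
  exact (ENNReal.add_right_inj hfin).1 h2

end General

end

end CountableChain

namespace FairLoad

noncomputable section

open CountableChain

/-! ### Arrivals, back-off values and transitions -/

lemma arrivals_apply (lam t : ℝ≥0) (j : ℕ) :
    arrivals lam t j
      = ENNReal.ofReal (Real.exp (-(lam * t : ℝ≥0)) * (lam * t : ℝ≥0) ^ j / j.factorial) :=
  poissonMeasure_singleton _ _

lemma arrivals_pos {lam t : ℝ≥0} (hlam : 0 < lam) (ht : 0 < t) (j : ℕ) : 0 < arrivals lam t j := by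
  rw [arrivals_apply, ENNReal.ofReal_pos]
  positivity

lemma expect_arrivals (lam t : ℝ≥0) :
    expect (arrivals lam t) (fun j => (j : ℝ≥0∞)) = (lam * t : ℝ≥0) := by
  rw [expect, tsum_eq_zero_add' ENNReal.summable, Nat.cast_zero, mul_zero, zero_add]
  have h1 : ∀ j : ℕ, arrivals lam t (j + 1) * ((j + 1 : ℕ) : ℝ≥0∞)
      = (lam * t : ℝ≥0) * arrivals lam t j := by
    intro j
    rw [arrivals_apply, arrivals_apply, ← ENNReal.ofReal_natCast (j + 1),
      ← ENNReal.ofReal_coe_nnreal, ← ENNReal.ofReal_mul (by positivity),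
      ← ENNReal.ofReal_mul (by positivity), Nat.factorial_succ]
    congr 1
    push_cast
    field_simp
    ring
  simp only [h1]
  rw [ENNReal.tsum_mul_left, PMF.tsum_coe, mul_one]

lemma expect_arrivals_affine (lam t c d : ℝ≥0) (n : ℕ) :
    expect (arrivals lam t) (fun j => (c : ℝ≥0∞) * ((n + j : ℕ) : ℝ≥0∞) + d)
      = ((c * n + c * (lam * t) + d : ℝ≥0) : ℝ≥0∞) := by
  simp only [Nat.cast_add, mul_add, expect_add, expect_const, expect_const_mul, expect_arrivals]
  push_cast
  rfl

lemma sum_range_cast_mul_two {R : Type*} [CommSemiring R] (n : ℕ) :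
    (∑ i ∈ Finset.range (n + 1), (i : R)) * 2 = (n + 1) * n := by
  have h := congrArg (Nat.cast : ℕ → R) (Finset.sum_range_id_mul_two (n + 1))
  rw [Nat.add_sub_cancel] at h
  push_cast at h
  exact h

lemma expect_backoff (W : ℕ) :
    expect (PMF.uniformOfFintype (Fin (W + 1))) (fun u => ((u : ℕ) : ℝ≥0∞))
      = ((W / 2 : ℝ≥0) : ℝ≥0∞) := by
  have h1 : ∑ u : Fin (W + 1), ((u : ℕ) : ℝ≥0) = (W + 1) * (W / 2) := by
    rw [Fin.sum_univ_eq_sum_range (fun i => (i : ℝ≥0)) (W + 1)]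
    rw [mul_div_assoc', ← sum_range_cast_mul_two, mul_div_cancel_right₀ _ two_ne_zero]
  have h4 : ∑ u : Fin (W + 1), ((u : ℕ) : ℝ≥0∞) = (W + 1) * ((W / 2 : ℝ≥0) : ℝ≥0∞) := by
    exact_mod_cast congrArg ((↑) : ℝ≥0 → ℝ≥0∞) h1
  simp only [expect, PMF.uniformOfFintype_apply, ENNReal.tsum_mul_left, Fintype.card_fin]
  rw [tsum_fintype, h4]
  push_cast
  rw [← mul_assoc, ENNReal.inv_mul_cancel (by simp) (by finiteness), one_mul]

variable {W : ℕ} {lam T σ r : ℝ≥0} {hr : r ≤ 1}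

lemma expect_step (s : State W) (f : State W → ℝ≥0∞) :
    expect (step W lam T σ r hr s) f
      = (r : ℝ≥0∞) * expect (arrivals lam T) (fun j =>
          expect (PMF.uniformOfFintype (Fin (W + 1))) fun u => f (next s true j u))
        + ((1 - r : ℝ≥0) : ℝ≥0∞) * expect (arrivals lam σ) (fun j =>
          expect (PMF.uniformOfFintype (Fin (W + 1))) fun u => f (next s false j u)) := by
  simp only [step, expect_bind, expect_map]
  rw [expect, tsum_fintype, Fintype.sum_bool]
  simp [slotType]

lemma exists_of_step_ne_zero {s t : State W} (h : step W lam T σ r hr s t ≠ 0) :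
    ∃ full j u, slotType r hr full ≠ 0 ∧ t = next s full j u := by
  rw [← PMF.mem_support_iff, step, PMF.mem_support_bind_iff] at h
  obtain ⟨full, hfull, h⟩ := h
  obtain ⟨j, -, h⟩ := (PMF.mem_support_bind_iff _ _ _).1 h
  obtain ⟨u, -, h⟩ := (PMF.mem_support_map_iff _ _ _).1 h
  exact ⟨full, j, u, hfull, h.symm⟩

lemma step_next_pos (hlam : 0 < lam) (hT : 0 < T) (hσ : 0 < σ) (s : State W) {full : Bool}
    (hfull : slotType r hr full ≠ 0) (j : ℕ) (u : Fin (W + 1)) :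
    0 < step W lam T σ r hr s (next s full j u) := by
  rw [pos_iff_ne_zero, ← PMF.mem_support_iff, step, PMF.mem_support_bind_iff]
  refine ⟨full, hfull, (PMF.mem_support_bind_iff _ _ _).2 ⟨j, ?_, ?_⟩⟩
  · exact (arrivals_pos hlam (by split_ifs <;> assumption) j).ne'
  · exact (PMF.mem_support_map_iff _ _ _).2 ⟨u, by simp, rfl⟩

lemma slotType_true_ne_zero (h : 0 < r) : slotType r hr true ≠ 0 := by
  simp [slotType, h.ne']

lemma slotType_false_ne_zero (h : r < 1) : slotType r hr false ≠ 0 := by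
  have h1 : slotType r hr false = ((1 - r : ℝ≥0) : ℝ≥0∞) := rfl
  rw [h1]
  exact_mod_cast (tsub_pos_of_lt h).ne'

/-! ### States -/

lemma State.ext_iff' {s t : State W} :
    s = t ↔ s.counter = t.counter ∧ s.packets = t.packets := by
  rw [State.counter, State.counter, State.packets, State.packets, ← Prod.ext_iff]
  exact Subtype.ext_iff

lemma State.eq_idle_iff {s : State W} : s = State.idle W ↔ s.packets = 0 := by
  refine ⟨fun h => h ▸ rfl, fun h => State.ext_iff'.2 ⟨s.2 h, h⟩⟩

@[simp] lemma State.packets_mk' (k : Fin (W + 1)) (n : ℕ) : (State.mk' k n).packets = n := rfl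

lemma State.counter_mk' (k : Fin (W + 1)) {n : ℕ} (hn : n ≠ 0) : (State.mk' k n).counter = k :=
  if_neg hn

lemma State.mk'_zero (k : Fin (W + 1)) : State.mk' k 0 = State.idle W :=
  State.eq_idle_iff.2 rfl

lemma State.mk'_self (s : State W) : State.mk' s.counter s.packets = s := by
  by_cases h : s.packets = 0
  · rw [State.eq_idle_iff.2 h]
    rfl
  · exact State.ext_iff'.2 ⟨State.counter_mk' _ h, rfl⟩

lemma packets_le_packets_next (s : State W) (full : Bool) (j : ℕ) (u : Fin (W + 1)) :
    s.packets ≤ (next s full j u).packets + 1 := by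
  unfold next
  split_ifs <;> simp <;> omega

/-! ### Irreducibility -/

/-- Arrivals and back-off draws both have full support, so one mini-slot leads from idle to any
state, idle included. -/
lemma step_idle_pos (hlam : 0 < lam) (hT : 0 < T) (hσ : 0 < σ) (hr1 : r < 1) (t : State W) :
    0 < step W lam T σ r hr (State.idle W) t := by
  have h := step_next_pos hlam hT hσ (State.idle W) (slotType_false_ne_zero (hr := hr) hr1)
    t.packets t.counter
  have h1 : next (State.idle W) false t.packets t.counter = t := State.mk'_self t
  rwa [h1] at h

/-- With no arrivals, mini-slots run the counter down to `0` and a full slot then removes a packet,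
the next draw being `0`. -/
lemma exists_nStep_mk'_idle_pos (hlam : 0 < lam) (hT : 0 < T) (hσ : 0 < σ) (hr0 : 0 < r)
    (hr1 : r < 1) (n : ℕ) (k : Fin (W + 1)) :
    ∃ m, 0 < nStep (step W lam T σ r hr) m (State.mk' k n) (State.idle W) := by
  induction n generalizing k with
  | zero => exact ⟨0, by simp [State.mk'_zero, nStep]⟩
  | succ n ih =>
    have hne := n.succ_ne_zero
    induction k using Fin.induction with
    | zero =>
      obtain ⟨m, hm⟩ := ih 0
      refine ⟨1 + m, nStep_add_pos ?_ hm⟩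
      rw [nStep_one]
      have h := step_next_pos hlam hT hσ (State.mk' (0 : Fin (W + 1)) (n + 1))
        (slotType_true_ne_zero (hr := hr) hr0) 0 0
      have h1 : next (State.mk' (0 : Fin (W + 1)) (n + 1)) true 0 0 = State.mk' 0 n := by
        simp [next, State.counter_mk' _ hne]
      rwa [h1] at h
    | succ k ihk =>
      obtain ⟨m, hm⟩ := ihk
      refine ⟨1 + m, nStep_add_pos ?_ hm⟩
      rw [nStep_one]
      have h := step_next_pos hlam hT hσ (State.mk' k.succ (n + 1))
        (slotType_false_ne_zero (hr := hr) hr1) 0 0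
      have h1 : next (State.mk' k.succ (n + 1)) false 0 0 = State.mk' k.castSucc (n + 1) := by
        simp [next, State.counter_mk' _ hne]
        rfl
      rwa [h1] at h

lemma isIrreducible_step (hlam : 0 < lam) (hT : 0 < T) (hσ : 0 < σ) (hr0 : 0 < r) (hr1 : r < 1) :
    IsIrreducible (step W lam T σ r hr) := by
  intro s t
  obtain ⟨m, hm⟩ := exists_nStep_mk'_idle_pos (hr := hr) hlam hT hσ hr0 hr1 s.packets s.counter
  rw [State.mk'_self] at hm
  refine ⟨m + 1, nStep_add_pos hm ?_⟩
  rw [nStep_one]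
  exact step_idle_pos hlam hT hσ hr1 t

/-- Without full slots nothing is ever transmitted, so a nonempty buffer never empties. -/
lemma not_isIrreducible_step_zero (hr : (0 : ℝ≥0) ≤ 1) :
    ¬ IsIrreducible (step W lam T σ 0 hr) := by
  intro h
  have h0 : ∀ n (s : State W), s.packets ≠ 0 →
      nStep (step W lam T σ 0 hr) n s (State.idle W) = 0 := by
    intro n
    induction n with
    | zero =>
      intro s hs
      exact PMF.pure_apply_of_ne _ _ fun h => hs (State.eq_idle_iff.1 h.symm)
    | succ n ih =>
      intro s hs
      rw [nStep_succ_apply, ← nonpos_iff_eq_zero]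
      refine (expect_mono _ (g := fun _ => 0) fun t ht => ?_).trans_eq (expect_const _ 0)
      obtain ⟨full, j, u, hfull, rfl⟩ := exists_of_step_ne_zero ht
      refine (ih _ ?_).le
      cases full
      · unfold next
        split_ifs <;> simp_all
      · simp [slotType] at hfull
  obtain ⟨n, hn⟩ := h (State.mk' 0 1) (State.idle W)
  exact hn.ne' (h0 n _ one_ne_zero)

/-! ### The workload and its drift -/

/-- The mean number of slots, up to an additive constant, that the station needs for the packets in
its buffer, when the service of a packet takes `C` slots and one decrement of the counter `g`. -/
def workload (C g : ℝ≥0) (s : State W) : ℝ≥0 :=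
  if s.packets = 0 then g * (W / 2) else C * s.packets + g * (s.counter : ℕ)

/-- The idle value of `workload` is chosen so that this formula also holds at `n = 0`, where the
draw is discarded. -/
lemma expect_workload_mk' (C g : ℝ≥0) (n : ℕ) :
    expect (PMF.uniformOfFintype (Fin (W + 1))) (fun u => (workload C g (State.mk' u n) : ℝ≥0∞))
      = (C : ℝ≥0∞) * n + (g * (W / 2) : ℝ≥0) := by
  rcases eq_or_ne n 0 with rfl | hn
  · simp only [workload, State.packets_mk', if_true, expect_const]
    simp
  · simp only [workload, State.packets_mk', if_neg hn, State.counter_mk' _ hn, ENNReal.coe_add,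
      ENNReal.coe_mul, ENNReal.coe_natCast, expect_add, expect_const, expect_const_mul,
      expect_backoff]

/-- The condition `hg` gives drift `-1` before arrivals when the counter is positive. At counter `0`
every slot redraws, at cost `gW/2`, and a full slot removes `C`; `hC` balances these to `-1`. -/
lemma expect_workload_add_one {C g : ℝ≥0} (hg : (1 - r) * g = 1) (hC : r * C = 1 + g * (W / 2))
    (s : State W) [Decidable (s = State.idle W)] :
    expect (step W lam T σ r hr s) (fun t => (workload C g t : ℝ≥0∞)) + 1
      = workload C g s + (((C * (lam * (r * T + (1 - r) * σ)) : ℝ≥0) : ℝ≥0∞)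
        + if s = State.idle W then 1 else 0) := by
  rw [expect_step]
  have hrr : (r : ℝ) + (1 - r : ℝ≥0) = 1 := by exact_mod_cast add_tsub_cancel_of_le hr
  -- Only `r + r' = 1` is needed about the truncated difference.
  generalize 1 - r = r' at *
  replace hg : (r' : ℝ) * g = 1 := by exact_mod_cast hg
  replace hC : (r : ℝ) * C = 1 + g * (W / 2) := by
    have h := congrArg ((↑) : ℝ≥0 → ℝ) hC
    push_cast at h
    exact h
  by_cases hs : s.packets = 0
  · rw [if_pos (State.eq_idle_iff.2 hs)]
    simp only [next, workload, if_pos hs]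
    change _ * expect _ (fun j => expect _ fun u => (workload C g (State.mk' u j) : ℝ≥0∞))
      + _ * expect _ (fun j => expect _ fun u => (workload C g (State.mk' u j) : ℝ≥0∞)) + 1 = _
    have h := fun t => expect_arrivals_affine lam t C (g * (W / 2)) 0
    simp only [zero_add] at h
    simp only [expect_workload_mk', h]
    norm_cast
    rw [← NNReal.coe_inj]
    push_cast
    linear_combination (g * (W / 2) : ℝ) * hrr
  · rw [if_neg (mt State.eq_idle_iff.1 hs)]
    by_cases hk : s.counter = 0
    · simp only [next, if_neg hs, if_pos hk, if_true, Bool.false_eq_true, if_false,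
        expect_workload_mk', expect_arrivals_affine]
      rw [workload, if_neg hs, hk]
      obtain ⟨n, hn⟩ := Nat.exists_eq_succ_of_ne_zero hs
      rw [hn, Nat.succ_sub_one, Fin.val_zero]
      norm_cast
      rw [← NNReal.coe_inj]
      push_cast
      linear_combination (g * (W / 2) + C * (n + 1) : ℝ) * hrr - hC
    · have hn : ∀ j, s.packets + j ≠ 0 := fun j => by omega
      simp only [next, if_neg hs, if_neg hk, if_true, Bool.false_eq_true, if_false, expect_const]
      simp only [workload, State.packets_mk', if_neg (hn _), State.counter_mk' _ (hn _), if_neg hs,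
        ENNReal.coe_add (C * _), ENNReal.coe_mul C, ENNReal.coe_natCast, expect_arrivals_affine]
      obtain ⟨k, hk'⟩ := Nat.exists_eq_succ_of_ne_zero (fun h => hk (Fin.ext h))
      rw [hk', Nat.succ_sub_one]
      norm_cast
      rw [← NNReal.coe_inj]
      push_cast
      linear_combination (C * s.packets + g * (k + 1) : ℝ) * hrr - hg

/-- At most one packet leaves per slot, costing `C`; `gW` bounds the counter term and `gW/2` is the
idle value. -/
lemma workload_le_of_step_ne_zero (C g : ℝ≥0) {s t : State W}
    (h : step W lam T σ r hr s t ≠ 0) :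
    workload C g s ≤ workload C g t + (C + (g * W + g * (W / 2))) := by
  obtain ⟨full, j, u, -, rfl⟩ := exists_of_step_ne_zero h
  have h1 : workload C g s ≤ C * s.packets + (g * W + g * (W / 2)) := by
    unfold workload
    split_ifs
    · exact le_add_self.trans le_add_self
    · gcongr
      refine le_add_right (mul_le_mul_right ?_ g)
      exact_mod_cast Nat.lt_succ_iff.1 s.counter.2
  have h2 : ∀ t : State W, C * t.packets ≤ workload C g t := by
    intro t
    unfold workload
    split_ifs with h
    · simp [h]
    · exact le_self_add
  have h3 : C * s.packets ≤ workload C g (next s full j u) + C := by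
    calc C * s.packets ≤ C * ((next s full j u).packets + 1) := by
          gcongr
          exact_mod_cast packets_le_packets_next s full j u
      _ ≤ _ := by
          rw [mul_add, mul_one]
          exact add_le_add_left (h2 _) C
  refine h1.trans ?_
  rw [← add_assoc (workload _ _ _)]
  exact add_le_add_left h3 _

lemma idle_add_load_eq_one {C g : ℝ≥0} (hg : (1 - r) * g = 1) (hC : r * C = 1 + g * (W / 2))
    {q : PMF (State W)} (hq : IsStationary (step W lam T σ r hr) q) :
    ((C * (lam * (r * T + (1 - r) * σ)) : ℝ≥0) : ℝ≥0∞) + q (State.idle W) = 1 := by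
  classical
  have h := hq.expect_drift_eq (f := fun s => (workload C g s : ℝ≥0∞)) (A := fun _ => 1)
    (B := fun s => ((C * (lam * (r * T + (1 - r) * σ)) : ℝ≥0) : ℝ≥0∞)
      + if s = State.idle W then 1 else 0) (K := ((C + (g * W + g * (W / 2)) : ℝ≥0) : ℝ≥0∞))
    ENNReal.coe_ne_top (fun s => ENNReal.coe_ne_top)
    (fun s t hst => by exact_mod_cast workload_le_of_step_ne_zero C g hst)
    (fun s => expect_workload_add_one hg hC s)
  rw [expect_const, expect_add, expect_const, expect_indicator] at h
  exact h.symm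

lemma exists_isStationary_step {C g : ℝ≥0} (hg : (1 - r) * g = 1) (hC : r * C = 1 + g * (W / 2))
    (hload : C * (lam * (r * T + (1 - r) * σ)) < 1) :
    ∃ q : PMF (State W), IsStationary (step W lam T σ r hr) q := by
  classical
  set β : ℝ≥0 := C * (lam * (r * T + (1 - r) * σ)) with hβ
  refine exists_isStationary (a := State.idle W)
    (tsum_survive_lt_top_of_drift (g := fun t => (workload C g t : ℝ≥0∞))
      (ε := ((1 - β : ℝ≥0) : ℝ≥0∞)) ?_ (fun s hs => ?_) ?_)
  · exact_mod_cast (tsub_pos_of_lt hload).ne'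
  · have h := expect_workload_add_one (lam := lam) (T := T) (σ := σ) (hr := hr) hg hC s
    rw [if_neg hs, add_zero, ← hβ] at h
    refine ((ENNReal.add_left_inj (ENNReal.coe_ne_top (r := β))).1 ?_).le
    rw [← h, add_assoc, ← ENNReal.coe_add, tsub_add_cancel_of_le hload.le, ENNReal.coe_one]
  · have h := expect_workload_add_one (lam := lam) (T := T) (σ := σ) (hr := hr) hg hC
      (State.idle W)
    refine ne_top_of_le_ne_top ?_ (le_self_add.trans_eq h)
    rw [if_pos rfl]
    finiteness

lemma isErgodic_step_iff {C g : ℝ≥0} (hlam : 0 < lam) (hT : 0 < T) (hσ : 0 < σ) (hr0 : 0 < r)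
    (hr1 : r < 1) (hg : (1 - r) * g = 1) (hC : r * C = 1 + g * (W / 2)) :
    IsErgodic (step W lam T σ r hr) ↔ C * (lam * (r * T + (1 - r) * σ)) < 1 := by
  have hirr : IsIrreducible (step W lam T σ r hr) := isIrreducible_step hlam hT hσ hr0 hr1
  constructor
  · intro h
    obtain ⟨q, hq⟩ := exists_isStationary (h.2.2.tsum_survive_lt_top (State.idle W))
    have h1 := idle_add_load_eq_one hg hC hq
    have h2 := hq.pos hirr (State.idle W)
    rw [← ENNReal.coe_lt_coe, ENNReal.coe_one, ← h1]
    exact ENNReal.lt_add_right ENNReal.coe_ne_top h2.ne'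
  · intro h
    obtain ⟨q, hq⟩ := exists_isStationary_step (hr := hr) hg hC h
    exact ⟨hirr, isAperiodic_of_pos hirr (step_idle_pos hlam hT hσ hr1 _),
      hq.isPositiveRecurrent hirr⟩

/-! ### The derivative of `Rbar` at `1` -/

lemma hasDerivAt_Rbar (W : ℕ) (lam T σ : ℝ) {r : ℝ} (hr : r < 1) :
    HasDerivAt (Rbar W lam T σ r)
      (lam * (r * T + (1 - r) * σ) * (1 + W / (2 * (1 - r))) - r) 1 := by
  have hr' : 1 - r ≠ 0 := (sub_pos.2 hr).ne'
  have hexp : ∀ c : ℝ, HasDerivAt (fun x : ℝ => Real.exp (-lam * c * (1 - x))) (lam * c) 1 := by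
    intro c
    have h := (((hasDerivAt_id (1 : ℝ)).const_sub 1).const_mul (-lam * c)).exp
    simpa using h
  have ha : HasDerivAt (a lam σ r) ((1 - r) * (lam * σ)) 1 := (hexp σ).const_mul _
  have hb : HasDerivAt (b lam T r) (-(r * (lam * T))) 1 := ((hexp T).const_mul r).const_sub 1
  have ha1 : a lam σ r 1 = 1 - r := by simp [a]
  have hb1 : b lam T r 1 = 1 - r := by simp [b]
  have hu1 : u lam T σ r 1 = 1 := by rw [u, ha1, hb1, div_self hr']
  -- This is the derivative of `u` at `1`. As `u` equals `1` there, the fraction in `Rbar`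
  -- contributes `Wd - Wd/2 = Wd/2`.
  set d : ℝ := -(lam * (r * T + (1 - r) * σ)) / (1 - r) with hd
  have hu : HasDerivAt (u lam T σ r) d 1 := by
    have h := hb.div ha (by rwa [ha1])
    rw [ha1, hb1] at h
    refine h.congr_deriv ?_
    rw [hd]
    field_simp
    ring
  have hnum : HasDerivAt (fun x => ((W : ℝ) + 1) * u lam T σ r x ^ W) ((W + 1) * (W * d)) 1 := by
    have h := (hu.pow W).const_mul ((W : ℝ) + 1)
    simpa [hu1] using h
  have hden : HasDerivAt (fun x => ∑ i ∈ Finset.range (W + 1), u lam T σ r x ^ i)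
      ((W + 1) * (W / 2) * d) 1 := by
    have h := HasDerivAt.fun_sum (u := Finset.range (W + 1)) fun i _ => hu.pow i
    simp only [hu1, one_pow, mul_one] at h
    refine (h.congr_deriv ?_).congr_of_eventuallyEq (.of_forall fun x => by simp)
    rw [← Finset.sum_mul]
    linear_combination (d / 2) * sum_range_cast_mul_two (R := ℝ) W
  have hW : (W : ℝ) + 1 ≠ 0 := by positivity
  have h1 := (((hexp T).const_mul r).div (hasDerivAt_id (1 : ℝ)) one_ne_zero).add ha
  have h2 := h1.sub (hnum.div hden (by simp [hu1, hW]))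
  refine h2.congr_deriv ?_
  simp [hu1, hd]
  field_simp
  ring

end

end FairLoad

theorem mainTheorem3 (W : ℕ) (lam T σ r : ℝ≥0) (hlam : 0 < lam) (hT : 0 < T) (hσ : 0 < σ)
    (hr : r < 1) :
    DifferentiableAt ℝ (FairLoad.Rbar W lam T σ r) 1 ∧
    (CountableChain.IsErgodic (FairLoad.step W lam T σ r hr.le) ↔
      deriv (FairLoad.Rbar W lam T σ r) 1 < 0) ∧
    (deriv (FairLoad.Rbar W lam T σ r) 1 < 0 ↔
      (lam : ℝ) < r * (1 - r) / ((1 - r + W / 2) * (r * T + (1 - r) * σ))) ∧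
    (CountableChain.IsErgodic (FairLoad.step W lam T σ r hr.le) →
      ∃ q : PMF (FairLoad.State W),
        CountableChain.IsStationary (FairLoad.step W lam T σ r hr.le) q ∧
        (∀ q' : PMF (FairLoad.State W),
          CountableChain.IsStationary (FairLoad.step W lam T σ r hr.le) q' → q' = q) ∧
        (∀ s t : FairLoad.State W,
          Tendsto (fun n : ℕ => CountableChain.nStep (FairLoad.step W lam T σ r hr.le) n s t)
            atTop (𝓝 (q t))) ∧
        (q (FairLoad.State.idle W)).toReal =
          1 - lam * (r * T + (1 - r) * σ) * (1 + W / (2 * (1 - r))) / r) := by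
  have hr1 : (r : ℝ) < 1 := hr
  have hr' : (0 : ℝ) < 1 - r := sub_pos.2 hr1
  have hcast : ((1 - r : ℝ≥0) : ℝ) = 1 - r := by rw [NNReal.coe_sub hr.le, NNReal.coe_one]
  have hm : (0 : ℝ) < r * T + (1 - r) * σ := by positivity
  have hderiv := FairLoad.hasDerivAt_Rbar W lam T σ hr1
  -- Multiplying the derivative by `1 - r > 0` turns its sign into the explicit bound on `lam`.
  have hident : (lam * (r * T + (1 - r) * σ) * (1 + W / (2 * (1 - r))) - r : ℝ) * (1 - r)
      = lam * ((1 - r + W / 2) * (r * T + (1 - r) * σ)) - r * (1 - r) := by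
    field_simp
  set g : ℝ≥0 := (1 - r)⁻¹ with hgdef
  set C : ℝ≥0 := (1 + g * (W / 2)) / r with hCdef
  have hg : (1 - r) * g = 1 := mul_inv_cancel₀ (tsub_pos_of_lt hr).ne'
  have hC : 0 < r → r * C = 1 + g * (W / 2) := fun h => mul_div_cancel₀ _ h.ne'
  have hload : ((C * (lam * (r * T + (1 - r) * σ)) : ℝ≥0) : ℝ)
      = lam * (r * T + (1 - r) * σ) * (1 + W / (2 * (1 - r))) / r := by
    rw [hCdef, hgdef]
    push_cast [hcast]
    field_simp
  rw [hderiv.deriv]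
  have hpos : ¬ 0 < r → ¬ CountableChain.IsErgodic (FairLoad.step W lam T σ r hr.le) := by
    intro h
    obtain rfl : r = 0 := not_lt.1 h |>.antisymm zero_le
    exact fun h => FairLoad.not_isIrreducible_step_zero hr.le h.1
  refine ⟨hderiv.differentiableAt, ?_, ?_, fun herg => ?_⟩
  · by_cases h : 0 < r
    · have h0 : (0 : ℝ) < r := h
      rw [FairLoad.isErgodic_step_iff hlam hT hσ h hr hg (hC h), ← NNReal.coe_lt_coe, hload,
        NNReal.coe_one, div_lt_one h0, sub_neg]
    · refine iff_of_false (hpos h) ?_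
      obtain rfl : r = 0 := not_lt.1 h |>.antisymm zero_le
      rw [not_lt, NNReal.coe_zero, sub_zero]
      positivity
  · rw [lt_div_iff₀ (by positivity), ← sub_neg (a := (lam : ℝ) * _), ← hident]
    exact ⟨fun h => mul_neg_of_neg_of_pos h hr',
      fun h => ((mul_neg_iff.1 h).resolve_left fun h => h.2.not_gt hr').1⟩
  · have h : 0 < r := by_contra fun h => hpos h herg
    obtain ⟨q, hq⟩ := CountableChain.exists_isStationary
      (herg.2.2.tsum_survive_lt_top (FairLoad.State.idle W))
    have hloop := FairLoad.step_idle_pos (hr := hr.le) hlam hT hσ hr (FairLoad.State.idle W)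
    refine ⟨q, hq, fun q' hq' => hq.unique herg.1 hloop hq', hq.tendsto_nStep herg.1 hloop, ?_⟩
    have h1 := congrArg ENNReal.toReal (FairLoad.idle_add_load_eq_one hg (hC h) hq)
    rw [ENNReal.toReal_add ENNReal.coe_ne_top (q.apply_ne_top _), ENNReal.coe_toReal, hload,
      ENNReal.toReal_one] at h1
    linarith
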